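/- Let $0<q<1$, let $n\ge 0$, and let $\lambda=(\lambda_1\ge\dots\ge\lambda_n\ge 0)$ and $\mu=(\mu_1\ge\dots\ge\mu_n\ge0)$ be partitions with at most $n$ parts. Notation. Let $\delta_n=(n-1,n-2,\dots,1,0)$, and let $\delta_{n+1}$ stand, in $n$-tuples, for $(n,n-1,\dots,1)$. For an $n$-tuple $a$ of nonnegative integers put $|a|=\sum_{i=1}^n a_i$, $b(a)=\sum_{i=1}^n (i-1)a_i$ and $q^{a}=(q^{a_1},\dots,q^{a_n})$. Further let $(q;q)_m=\prod_{k=1}^m(1-q^k)$, $\overline{\Delta}(x)=\prod_{1\le i<j\le n}(x_j-x_i)$, and let $s_\lambda(x_1,\dots,x_n)=\det(x_j^{\lambda_i+n-i})_{i,j=1}^n/\det(x_j^{n-i})_{i,j=1}^n$ be the Schur function (for pairwise distinct $x_j$). An $(n,\lambda,\mu)$-Gelfand–Tsetlin pattern is an array $T=(x_{i,j})$ of nonnegative integers, indexed by $1\le j\le n$ and $1-\lambda_j\le i\le n+1-j$, such that $x_{i,j+1}\ge x_{i,j}\ge x_{i+1,j}$ (each inequality being required whenever both of its indices lie in the index set)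 and $x_{i,n+1-i}=\mu_i$ for $1\le i\le n$; let $\mathrm{GT}_n(\lambda,\mu)$ be the set of these patterns. Let $(\delta_{n+1}+\lambda)^*$ be the shifted diagram whose row $i$ consists of the cells $(i,j)$ with $i\le j\le n+\lambda_i$, for $1\le i\le n$, and let $\mathrm{RPP}((\delta_{n+1}+\lambda)^*)$ be the set of its fillings $T$ by nonnegative integers that weakly increase along rows and down columns. The reverse diagonal of such a $T$ is $\mathrm{rdiag}(T)=(T_{n,n},T_{n-1,n-1},\dots,T_{1,1})$. In both cases $|T|$ denotes the sum of all entries of $T$. Then the two series below converge, and \[ \sum_{T\in \mathrm{GT}_n(\lambda,\mu)}q^{|T|}=\sum_{\substack{T\in\mathrm{RPP}((\delta_{n+1}+\lambda)^*)\\ \mathrm{rdiag}(T)=\mu}}q^{|T|} = q^{|\mu|-b(\lambda)}\,s_\mu(q^{\delta_n})\,s_\lambda(q^{\mu+\delta_n})\prod_{j=1}^n\frac{(q;q)_{n-j}}{(q;q)_{\lambda_j+n-j}}. \] Equivalently, the common value is \[ \frac{q^{|\mu|-b(\delta_n+\lambda)}}{\prod_{j=1}^n(q;q)_{\lambda_j+n-j}}\,s_\lambda(q^{\mu+\delta_n})\,\overline{\Delta}(q^{\mu+\delta_n})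 =\frac{q^{-b(\delta_{n+1}+\lambda)}}{\prod_{j=1}^n(q;q)_{\lambda_j+n-j}}\,q^{|\mu+\delta_n|}\,s_\lambda(q^{\mu+\delta_n})\,\overline{\Delta}(q^{\mu+\delta_n}). \] -/

import Mathlib

/-! Conventions.  A partition with at most `n` parts is a weakly decreasing `n`-tuple of natural
numbers, that is a function `lam : Fin n → ℕ` with `Antitone lam`; the entry `lam i` is the part
with 1-based number `i + 1`. -/

noncomputable section

namespace QRPP

/-- The staircase `δ_n = (n-1, n-2, …, 1, 0)`. -/
def delta (n : ℕ) : Fin n → ℕ := fun i => n - 1 - (i : ℕ)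

/-- The nonzero parts `(n, n-1, …, 1)` of `δ_{n+1}`, as an `n`-tuple. -/
def deltaSucc (n : ℕ) : Fin n → ℕ := fun i => n - (i : ℕ)

/-- `|a| = a_1 + ⋯ + a_n`. -/
def wt {n : ℕ} (a : Fin n → ℕ) : ℕ := ∑ i : Fin n, a i

/-- `b(a) = ∑_{i=1}^n (i-1) a_i`. -/
def b {n : ℕ} (a : Fin n → ℕ) : ℕ := ∑ i : Fin n, (i : ℕ) * a i

/-- The point `q^a = (q^{a_1}, …, q^{a_n})`. -/
def qpow {n : ℕ} (q : ℝ) (a : Fin n → ℕ) : Fin n → ℝ := fun i => q ^ a i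

/-- The `q`-Pochhammer symbol `(a;q)_m = (1-a)(1-aq)⋯(1-aq^{m-1})`. -/
def qPoch (a q : ℝ) (m : ℕ) : ℝ := ∏ k ∈ Finset.range m, (1 - a * q ^ k)

/-- The alternant with exponents `a`: `det (x_j ^ a_i)`. -/
def alternant {n : ℕ} (a : Fin n → ℕ) (x : Fin n → ℝ) : ℝ :=
  Matrix.det (Matrix.of fun i j : Fin n => x j ^ a i)

/-- The value at `x` of the Schur function in `n` variables,
`s_lam(x) = det (x_j ^ (lam_i + n - i)) / det (x_j ^ (n - i))` (1-based `i`), for a point `x` with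
pairwise distinct coordinates; then the denominator, a Vandermonde determinant, is not zero. -/
def schur {n : ℕ} (lam : Fin n → ℕ) (x : Fin n → ℝ) : ℝ :=
  alternant (lam + delta n) x / alternant (delta n) x

/-- The Vandermonde product `∏_{i<j} (x_j - x_i)`. -/
def vdmBar {n : ℕ} (x : Fin n → ℝ) : ℝ := ∏ i : Fin n, ∏ j ∈ Finset.Ioi i, (x j - x i)

/-- The shifted diagram with row lengths `nu`: row `i` (0-based) consists of the `nu i` cells
`(i, j)` with `i ≤ j < i + nu i`. -/
def shiftedDiagram {n : ℕ} (nu : Fin n → ℕ) : Finset (ℕ × ℕ) :=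
  (Finset.univ : Finset (Fin n)).biUnion fun i =>
    (Finset.Ico (i : ℕ) ((i : ℕ) + nu i)).image fun j => ((i : ℕ), j)

/-- Reverse plane partitions of shape `S`: fillings of the cells of `S` with natural numbers that
weakly increase along rows and down columns.  As with tableaux in Mathlib, a filling is recorded as
a function on all cells that vanishes off `S`. -/
structure RPP (S : Finset (ℕ × ℕ)) where
  /-- The entry in a cell `(row, column)`. -/
  entry : ℕ × ℕ → ℕ
  row_weak : ∀ i j j' : ℕ, j ≤ j' → (i, j) ∈ S → (i, j') ∈ S → entry (i, j) ≤ entry (i, j')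
  col_weak : ∀ i i' j : ℕ, i ≤ i' → (i, j) ∈ S → (i', j) ∈ S → entry (i, j) ≤ entry (i', j)
  zeros : ∀ c : ℕ × ℕ, c ∉ S → entry c = 0

/-- `|T|`, the sum of the entries. -/
def RPP.size {S : Finset (ℕ × ℕ)} (T : RPP S) : ℕ := ∑ c ∈ S, T.entry c

/-- The reverse diagonal of a reverse plane partition whose main diagonal has the `n` cells
`(0,0), …, (n-1,n-1)`: the entries in these cells, read from southeast to northwest. -/
def RPP.rdiag {S : Finset (ℕ × ℕ)} (n : ℕ) (T : RPP S) : Fin n → ℕ :=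
  fun i => T.entry ((Fin.rev i : ℕ), (Fin.rev i : ℕ))

/-- The shifted diagram `(δ_{n+1} + lam)^*`. -/
def shape {n : ℕ} (lam : Fin n → ℕ) : Finset (ℕ × ℕ) := shiftedDiagram (deltaSucc n + lam)

/-- The index set `{(i,j) : 1 ≤ j ≤ n, 1 - lam_j ≤ i ≤ n + 1 - j}` of the generalized
Gelfand–Tsetlin patterns; both indices are 1-based, so `j` is `k + 1` for the `k : Fin n` with
`lam_j = lam k`. -/
def gtIndex {n : ℕ} (lam : Fin n → ℕ) : Finset (ℤ × ℤ) :=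
  (Finset.univ : Finset (Fin n)).biUnion fun k =>
    (Finset.Icc (1 - (lam k : ℤ)) ((n : ℤ) + 1 - ((k : ℤ) + 1))).image fun i => (i, (k : ℤ) + 1)

/-- `(n, lam, mu)`-Gelfand–Tsetlin patterns: arrays `x_{i,j}` of natural numbers indexed by
`gtIndex lam` (recorded as functions that vanish off this set) with
`x_{i,j+1} ≥ x_{i,j} ≥ x_{i+1,j}`, each inequality being required when both of its indices lie in
the index set, and with `x_{i,n+1-i} = mu_i` for `1 ≤ i ≤ n`. -/
structure GT {n : ℕ} (lam mu : Fin n → ℕ) where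
  /-- The entry `x_{i,j}`. -/
  entry : ℤ × ℤ → ℕ
  le_up : ∀ i j : ℤ, (i, j) ∈ gtIndex lam → (i, j + 1) ∈ gtIndex lam →
    entry (i, j) ≤ entry (i, j + 1)
  le_left : ∀ i j : ℤ, (i, j) ∈ gtIndex lam → (i + 1, j) ∈ gtIndex lam →
    entry (i + 1, j) ≤ entry (i, j)
  diag : ∀ k : Fin n, entry ((k : ℤ) + 1, (n : ℤ) + 1 - ((k : ℤ) + 1)) = mu k
  zeros : ∀ p : ℤ × ℤ, p ∉ gtIndex lam → entry p = 0

/-- `|T|`, the sum of the entries. -/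
def GT.size {n : ℕ} {lam mu : Fin n → ℕ} (T : GT lam mu) : ℕ := ∑ p ∈ gtIndex lam, T.entry p

/-- `q^{|mu| - b(lam)} s_mu(q^{δ_n}) s_lam(q^{mu+δ_n}) ∏_{j=1}^n (q;q)_{n-j} / (q;q)_{lam_j+n-j}`;
here `n - j` is `δ_n` at `j`. -/
def productForm {n : ℕ} (q : ℝ) (lam mu : Fin n → ℕ) : ℝ :=
  q ^ ((wt mu : ℤ) - (b lam : ℤ)) * schur mu (qpow q (delta n)) *
    schur lam (qpow q (mu + delta n)) *
    ∏ j : Fin n, qPoch q q (delta n j) / qPoch q q (lam j + delta n j)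

end QRPP

end

/-!
The proof reads a shifted reverse plane partition along its diagonals.  Put `l = lam + δ_n`; row
`i` of the shape `(δ_{n+1} + lam)^*` has `l i + 1` cells, so the `d`-th diagonal consists of the
rows with `d ≤ l i`.  As `l` is strictly decreasing, a diagonal has either as many cells as the
previous one or one cell less, and consecutive diagonals interlace.  The rows of such a partition,
read backwards, are the columns of a Gelfand–Tsetlin pattern (`gtEquiv`, `rppEquiv`), so both series
are the generating function of the same diagonal patterns (`IsPattern`).

With main diagonal `a_0 ≤ a_1 ≤ ⋯` (the reverse of `mu`) and `m_j = a_j + j`, this generating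
function is a power of `q` divided by `∏ (q;q)_{l_i}`, times `det (q^{m_j l_i})`
(`hasSum_pattern`).  The proof is by induction on the number of diagonals.  Removing the main
diagonal (`peel`) replaces `l` by `l - 1`.  The entries of the next diagonal vary independently:
`m_j` becomes a number in the interval `[m_j, m_{j+1})`, and in `[m_j, ∞)` in the last row.  Hence
the sum of determinants is a determinant of geometric sums (`hasSum_det`, `hasSum_slot`), with
entries `(q^{m_j l_i} - q^{m_{j+1} l_i}) / (1 - q^{l_i})`.  Column operations turn it into the
determinant for `l`, up to the factors `1 - q^{l_i}`.  If the last row has just one cell, then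
`l_i = 0` there, so the last row of `det (q^{m_j l_i})` is constantly `1` and the same column
operations reduce the size by one.

What remains is to recognize the determinant as `s_lam` times a Vandermonde product
(`schur_mul_vdmBar`), and to evaluate `s_mu(q^{δ_n})` as a quotient of two Vandermonde products
(`schur_qpow_delta`), the lower of which is explicit (`vdmBar_qpow_delta`).
-/

namespace QRPP

open Finset

/-! ### Sums of determinants over product sets -/

theorem hasSum_mul_prod {α β : Type*} {f : α → ℝ} {g : β → ℝ} {s t : ℝ} (hf : HasSum f s)
    (hg : HasSum g t) : HasSum (fun x : α × β => f x.1 * g x.2) (s * t) :=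
  hf.mul hg (summable_mul_of_summable_norm hf.summable.norm hg.summable.norm)

/-- A product over coordinates is summed factor by factor. -/
theorem hasSum_prod_pi {k : ℕ} {ι : Fin k → Type*} (f : ∀ i, ι i → ℝ) (s : Fin k → ℝ)
    (hf : ∀ i, HasSum (f i) (s i)) :
    HasSum (fun x : ∀ i, ι i => ∏ i, f i (x i)) (∏ i, s i) := by
  induction k with
  | zero => simp
  | succ k ih =>
    have h : HasSum (fun x : ∀ i : Fin k, ι i.succ => ∏ i : Fin k, f i.succ (x i))
        (∏ i : Fin k, s i.succ) := ih (fun i => f i.succ) (fun i => s i.succ) fun i => hf i.succ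
    have hm := hasSum_mul_prod (hf 0) h
    rw [← (Fin.consEquiv ι).hasSum_iff, Fin.prod_univ_succ]
    refine hm.congr_fun fun x => ?_
    simp [Fin.prod_univ_succ, Fin.consEquiv]

/-- A determinant is multilinear in its columns, so it commutes with independent summations in
the columns. -/
theorem hasSum_det {k : ℕ} {ι : Fin k → Type*} (g : Fin k → ∀ j, ι j → ℝ)
    (s : Fin k → Fin k → ℝ) (hg : ∀ i j, HasSum (g i j) (s i j)) :
    HasSum (fun x : ∀ j, ι j => (Matrix.of fun i j => g i j (x j)).det) (Matrix.of s).det := by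
  simp only [Matrix.det_apply', Matrix.of_apply]
  exact hasSum_sum fun σ _ => (hasSum_prod_pi (fun j => g (σ j) j) _ fun j => hg (σ j) j).mul_left _

/-- Subtracting from each column the next one does not change a determinant. -/
theorem det_eq_of_col_eq_add_next {k : ℕ} {A B : Matrix (Fin (k + 1)) (Fin (k + 1)) ℝ}
    (hlast : ∀ i, A i (Fin.last k) = B i (Fin.last k))
    (hcast : ∀ i (j : Fin k), A i j.castSucc = B i j.castSucc + A i j.succ) : A.det = B.det := by
  rw [← Matrix.det_submatrix_equiv_self Fin.revPerm A,
    ← Matrix.det_submatrix_equiv_self Fin.revPerm B]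
  refine Matrix.det_eq_of_forall_col_eq_smul_add_pred (fun _ => 1) (fun i => ?_) fun i j => ?_
  · simp [hlast]
  · simp [Fin.rev_succ, Fin.rev_castSucc, hcast]

theorem det_eq_det_castSucc {k : ℕ} (A : Matrix (Fin (k + 1)) (Fin (k + 1)) ℝ)
    (h0 : ∀ j : Fin k, A (Fin.last k) j.castSucc = 0) (h1 : A (Fin.last k) (Fin.last k) = 1) :
    A.det = (A.submatrix Fin.castSucc Fin.castSucc).det := by
  rw [Matrix.det_succ_row A (Fin.last k), Fin.sum_univ_castSucc]
  simp [h0, h1, Fin.succAbove_last]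

/-! ### Diagonal patterns and removal of the first diagonal -/

/-- Reverse plane partitions of a shifted shape, read along the diagonals: `t i d` is the entry of
row `i < k` on the `d`-th diagonal, where row `i` has the `l i + 1` cells `d = 0, …, l i`, and `a`
is the main diagonal.  Entries outside of the shape are zero. -/
structure IsPattern (k : ℕ) (l a : ℕ → ℕ) (t : ℕ → ℕ → ℕ) : Prop where
  zero : ∀ i d, ¬ (i < k ∧ d ≤ l i) → t i d = 0
  start : ∀ i < k, t i 0 = a i
  right : ∀ i d, i < k → d + 1 ≤ l i → t i d ≤ t i (d + 1)
  down : ∀ i d, i + 1 < k → d + 1 ≤ l i → d ≤ l (i + 1) → t i (d + 1) ≤ t (i + 1) d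

/-- The type of diagonal patterns with `k` rows, row lengths `l i + 1` and main diagonal `a`. -/
abbrev Pattern (k : ℕ) (l a : ℕ → ℕ) := {t : ℕ → ℕ → ℕ // IsPattern k l a t}

/-- The sum of the entries of a diagonal pattern. -/
def patternSize (k : ℕ) (l : ℕ → ℕ) (t : ℕ → ℕ → ℕ) : ℕ :=
  ∑ i ∈ range k, ∑ d ∈ range (l i + 1), t i d

/-- The values allowed in row `j` of the first off-diagonal when the main diagonal is `a`; in the
last row they are not bounded above. -/
def slot (k : ℕ) (a : ℕ → ℕ) (j : ℕ) : Set ℕ := {x | a j ≤ x ∧ (j + 1 < k → x ≤ a (j + 1))}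

/-- Extension of a tuple by zero. -/
def extend {k : ℕ} (f : Fin k → ℕ) (i : ℕ) : ℕ := if h : i < k then f ⟨i, h⟩ else 0

@[simp] theorem extend_val {k : ℕ} (f : Fin k → ℕ) (i : Fin k) : extend f i = f i := by
  simp [extend]

theorem extend_of_lt {k : ℕ} (f : Fin k → ℕ) {i : ℕ} (h : i < k) : extend f i = f ⟨i, h⟩ := by
  simp [extend, h]

/-- Removing the main diagonal.  The `k'` rows that have more than one cell remain; the next
diagonal interlaces with the removed one. -/
def peel {k k' : ℕ} {l a : ℕ → ℕ} (hk : k' ≤ k) (hl : ∀ i < k, 0 < l i ↔ i < k') :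
    Pattern k l a ≃
      Σ b : (∀ j : Fin k', slot k a j), Pattern k' (fun i => l i - 1) (extend fun j => b j) where
  toFun t := ⟨fun j => ⟨t.1 j 1, by
      have hj : (j : ℕ) < k := j.2.trans_le hk
      have hlj := (hl j hj).2 j.2
      refine ⟨?_, fun h => ?_⟩
      · rw [← t.2.start j hj]
        exact t.2.right j 0 hj hlj
      · rw [← t.2.start _ h]
        exact t.2.down j 0 h hlj (Nat.zero_le _)⟩,
    ⟨fun i d => t.1 i (d + 1), by
      refine ⟨fun i d h => ?_, fun i h => ?_, fun i d h h' => ?_, fun i d h h' h'' => ?_⟩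
      · refine t.2.zero _ _ fun hh => h ?_
        have := (hl i hh.1).1 (by omega)
        exact ⟨this, by omega⟩
      · simp [extend, h]
      · exact t.2.right _ _ (by omega) (by omega)
      · have := (hl (i + 1) (by omega)).2 h
        exact t.2.down _ _ (by omega) (by omega) (by omega)⟩⟩
  invFun p := ⟨fun i d => Nat.casesOn d (if i < k then a i else 0) fun d => p.2.1 i d, by
    obtain ⟨b, t, ht⟩ := p
    have hs : ∀ i (h : i < k'), t i 0 = b ⟨i, h⟩ := fun i h => by
      rw [ht.start i h, extend_of_lt _ h]
    refine ⟨fun i d h => ?_, fun i h => ?_, fun i d h h' => ?_, fun i d h h' h'' => ?_⟩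
    · cases d with
      | zero => exact if_neg fun hh => h ⟨hh, Nat.zero_le _⟩
      | succ d => exact ht.zero _ _ fun hh => h ⟨by omega, by have := (hl i (by omega)).2 hh.1; omega⟩
    · exact if_pos h
    · have hi := (hl i h).1 (by omega)
      cases d with
      | zero =>
        simp only [h, if_true]
        rw [hs i hi]
        exact (b ⟨i, hi⟩).2.1
      | succ d => exact ht.right _ _ hi (by omega)
    · have hi := (hl i (by omega)).1 (by omega)
      cases d with
      | zero =>
        simp only [h, if_true]
        rw [hs i hi]
        exact (b ⟨i, hi⟩).2.2 h
      | succ d =>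
        have hi' := (hl (i + 1) h).1 (by omega)
        exact ht.down _ _ hi' (by omega) (by omega)⟩
  left_inv t := by
    apply Subtype.ext
    funext i d
    cases d with
    | zero =>
      change (if i < k then a i else 0) = _
      split_ifs with h
      · exact (t.2.start i h).symm
      · exact (t.2.zero _ _ (by omega)).symm
    | succ d => rfl
  right_inv p := by
    refine Sigma.subtype_ext ?_ rfl
    funext j
    apply Subtype.ext
    change p.2.1 j 0 = _
    rw [p.2.2.start j j.2, extend_val]

theorem patternSize_eq_add {k k' : ℕ} {l a : ℕ → ℕ} (hk : k' ≤ k)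
    (hl : ∀ i < k, 0 < l i ↔ i < k') {t : ℕ → ℕ → ℕ} (ht : IsPattern k l a t) :
    patternSize k l t
      = ∑ i ∈ range k, a i + patternSize k' (fun i => l i - 1) fun i d => t i (d + 1) := by
  have h1 : ∀ i ∈ range k, ∑ d ∈ range (l i + 1), t i d
      = a i + ∑ d ∈ range (l i), t i (d + 1) := fun i hi => by
    rw [sum_range_succ', ht.start i (mem_range.1 hi), add_comm]
  rw [patternSize, sum_congr rfl h1, sum_add_distrib, patternSize]
  congr 1
  symm
  rw [← sum_subset (range_subset_range.2 hk)]
  · refine sum_congr rfl fun i hi => ?_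
    have hi' := mem_range.1 hi
    have := (hl i (by omega)).2 hi'
    rw [Nat.sub_add_cancel this]
  · intro i hi hi'
    have h0 : ¬ 0 < l i := fun h => hi' (mem_range.2 ((hl i (mem_range.1 hi)).1 h))
    simp [Nat.eq_zero_of_not_pos h0]

/-! ### The generating function of diagonal patterns -/

/-- The numerator, over the denominator `1 - u`, of the geometric sum `∑ u ^ (x + j)` over `x` in
`slot k a j`. -/
noncomputable def slotNum (k : ℕ) (a : ℕ → ℕ) (u : ℝ) (j : ℕ) : ℝ :=
  if j + 1 < k then u ^ (a j + j) - u ^ (a (j + 1) + (j + 1)) else u ^ (a j + j)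

theorem hasSum_slot {k : ℕ} {a : ℕ → ℕ} {u : ℝ} (hu0 : 0 ≤ u) (hu1 : u < 1) (j : ℕ)
    (ha : j + 1 < k → a j ≤ a (j + 1)) :
    HasSum (fun x : slot k a j => u ^ ((x : ℕ) + j)) ((1 - u)⁻¹ * slotNum k a u j) := by
  by_cases hj : j + 1 < k
  · have hS : slot k a j = ↑(Ico (a j) (a (j + 1) + 1)) := by
      ext x
      simp [slot, hj]
    rw [hS]
    have h := (Ico (a j) (a (j + 1) + 1)).hasSum fun x => u ^ (x + j)
    have hval : (1 - u)⁻¹ * slotNum k a u j = ∑ x ∈ Ico (a j) (a (j + 1) + 1), u ^ (x + j) := by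
      simp only [slotNum, if_pos hj, pow_add _ _ j]
      rw [← sum_mul, geom_sum_Ico' hu1.ne (by have := ha hj; omega)]
      have : (1 - u) ≠ 0 := by linarith
      field_simp
      ring
    rw [hval]
    exact h
  · let e : ℕ ≃ slot k a j :=
      { toFun := fun d => ⟨a j + d, Nat.le_add_right _ _, fun h => absurd h hj⟩
        invFun := fun x => x - a j
        left_inv := fun d => by simp
        right_inv := fun x => Subtype.ext (Nat.add_sub_cancel' x.2.1) }
    rw [← e.hasSum_iff]
    simp only [slotNum, if_neg hj]
    refine ((hasSum_geometric_of_lt_one hu0 hu1).mul_right _).congr_fun fun d => ?_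
    change u ^ (a j + d + j) = _
    ring

/-- The column operations that undo the telescoping when no row ends at the main diagonal. -/
theorem det_slotNum {k : ℕ} {a : ℕ → ℕ} (u : Fin k → ℝ) :
    (Matrix.of fun i j : Fin k => slotNum k a (u i) j).det
      = (Matrix.of fun i j : Fin k => u i ^ (a j + j)).det := by
  cases k with
  | zero => simp
  | succ k =>
    symm
    refine det_eq_of_col_eq_add_next (fun i => ?_) fun i j => ?_ <;> simp [slotNum]

/-- The same column operations when the last row ends at the main diagonal: its base is `q ^ 0 = 1`,
so that only the entry in the last column survives in the last row. -/
theorem det_slotNum_castSucc {k : ℕ} {a : ℕ → ℕ} (u : Fin (k + 1) → ℝ)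
    (hu : u (Fin.last k) = 1) :
    (Matrix.of fun i j : Fin k => slotNum (k + 1) a (u i.castSucc) j).det
      = (Matrix.of fun i j : Fin (k + 1) => u i ^ (a j + j)).det := by
  rw [← det_slotNum, det_eq_det_castSucc]
  · rfl
  · simp [slotNum, hu]
  · simp [slotNum, hu]

/-- The generating function of diagonal patterns, in determinantal form. -/
noncomputable def patternGF (q : ℝ) (k : ℕ) (l a : ℕ → ℕ) : ℝ :=
  q ^ (∑ j ∈ range k, (a j + j)) / q ^ (∑ i ∈ range k, i * (l i + 1)) /
    (∏ i ∈ range k, qPoch q q (l i)) *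
    (Matrix.of fun i j : Fin k => (q ^ l i) ^ (a j + j)).det

theorem qPoch_succ (q : ℝ) (m : ℕ) : qPoch q q (m + 1) = qPoch q q m * (1 - q ^ (m + 1)) := by
  rw [qPoch, prod_range_succ, ← qPoch, pow_succ']

/-- Summation of the determinantal formula over all diagonals interlacing with `a`. -/
theorem hasSum_patternGF {q : ℝ} (hq0 : 0 < q) (hq1 : q < 1) {k k' : ℕ} {l a : ℕ → ℕ}
    (hk : k' ≤ k) (hl : ∀ i < k, 0 < l i ↔ i < k') (ha : ∀ i, i + 1 < k → a i ≤ a (i + 1))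
    (hk' : k = k' ∨ k = k' + 1) :
    HasSum (fun b : (∀ j : Fin k', slot k a j) =>
        q ^ (∑ i ∈ range k, a i) * patternGF q k' (fun i => l i - 1) (extend fun j => b j))
      (patternGF q k l a) := by
  have hpos : ∀ i : Fin k', 0 < l i := fun i => (hl i (i.2.trans_le hk)).2 i.2
  have hsum := hasSum_det (fun (i j : Fin k') (x : slot k a j) => (q ^ l i) ^ ((x : ℕ) + j)) _
    fun i j => hasSum_slot (pow_nonneg hq0.le _) (pow_lt_one₀ hq0.le hq1 (hpos i).ne') j
      (ha j)
  have hfactor := Matrix.det_mul_column (fun i : Fin k' => (1 - q ^ l i)⁻¹)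
    (Matrix.of fun i j : Fin k' => slotNum k a (q ^ l i) j)
  simp only [Matrix.of_apply] at hfactor
  rw [hfactor] at hsum
  have hdet : (Matrix.of fun i j : Fin k' => slotNum k a (q ^ l i) j).det
      = (Matrix.of fun i j : Fin k => (q ^ l i) ^ (a j + j)).det := by
    rcases hk' with rfl | rfl
    · exact det_slotNum fun i => q ^ l i
    · refine det_slotNum_castSucc (fun i => q ^ l i) ?_
      have : l k' = 0 := by
        by_contra h
        exact absurd ((hl k' (by omega)).1 (by omega)) (lt_irrefl _)
      simp [this]
  have hout : ∀ i ∈ range k, i ∉ range k' → l i = 0 := fun i hi hi' => by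
    by_contra h
    exact hi' (mem_range.2 ((hl i (mem_range.1 hi)).1 (by omega)))
  have hP : ∏ i ∈ range k, qPoch q q (l i)
      = (∏ i ∈ range k', qPoch q q (l i - 1)) * ∏ i : Fin k', (1 - q ^ l i) := by
    rw [← prod_subset (range_subset_range.2 hk), Fin.prod_univ_eq_prod_range (fun i => 1 - q ^ l i),
      ← prod_mul_distrib]
    · refine prod_congr rfl fun i hi => ?_
      have := hpos ⟨i, mem_range.1 hi⟩
      obtain ⟨m, hm⟩ : ∃ m, l i = m + 1 := ⟨l i - 1, by simp at this; omega⟩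
      rw [hm, qPoch_succ, Nat.add_sub_cancel]
    · intro i hi hi'
      simp [hout i hi hi', qPoch]
  have hE : ∑ i ∈ range k, i * (l i + 1)
      = ∑ i ∈ range k, i + ∑ i ∈ range k', i * (l i - 1 + 1) := by
    have h1 : ∑ i ∈ range k, i * (l i + 1) = ∑ i ∈ range k, i + ∑ i ∈ range k, i * l i := by
      rw [← sum_add_distrib]
      exact sum_congr rfl fun i _ => by ring
    rw [h1]
    congr 1
    symm
    rw [← sum_subset (range_subset_range.2 hk)]
    · refine sum_congr rfl fun i hi => ?_
      have := hpos ⟨i, mem_range.1 hi⟩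
      obtain ⟨m, hm⟩ : ∃ m, l i = m + 1 := ⟨l i - 1, by simp at this; omega⟩
      rw [hm, Nat.add_sub_cancel]
    · intro i hi hi'
      simp [hout i hi hi']
  have hfin := hsum.mul_left (q ^ (∑ i ∈ range k, a i) /
    q ^ (∑ i ∈ range k', i * (l i - 1 + 1)) / ∏ i ∈ range k', qPoch q q (l i - 1))
  rw [hdet] at hfin
  have hval : patternGF q k l a = q ^ (∑ i ∈ range k, a i) /
      q ^ (∑ i ∈ range k', i * (l i - 1 + 1)) / (∏ i ∈ range k', qPoch q q (l i - 1)) *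
      ((∏ i : Fin k', (1 - q ^ l i)⁻¹) *
        (Matrix.of fun i j : Fin k => (q ^ l i) ^ (a j + j)).det) := by
    simp only [patternGF]
    rw [hP, hE, sum_add_distrib, pow_add, pow_add, prod_inv_distrib]
    have : q ^ (∑ i ∈ range k, i) ≠ 0 := by positivity
    field_simp
  rw [hval]
  refine hfin.congr_fun fun b => ?_
  -- The weight of the new diagonal is absorbed into the columns and raises `l i - 1` to `l i`.
  have hcol : (Matrix.of fun i j : Fin k' => (q ^ l i) ^ ((b j : ℕ) + j)).det
      = q ^ (∑ j ∈ range k', (extend (fun j => (b j : ℕ)) j + j)) *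
        (Matrix.of fun i j : Fin k' =>
          (q ^ (l i - 1)) ^ (extend (fun j => (b j : ℕ)) j + j)).det := by
    rw [← prod_pow_eq_pow_sum, ← Fin.prod_univ_eq_prod_range
      (fun j => q ^ (extend (fun j => (b j : ℕ)) j + j)), ← Matrix.det_mul_row]
    congr 1
    ext i j
    have := hpos i
    obtain ⟨m, hm⟩ : ∃ m, l i = m + 1 := ⟨l i - 1, by omega⟩
    simp only [Matrix.of_apply, extend_val, hm, Nat.add_sub_cancel]
    rw [pow_succ, mul_pow, mul_comm]
  rw [hcol, patternGF]
  ring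

/-- The generating function of diagonal patterns with strictly decreasing row lengths. -/
theorem hasSum_pattern {q : ℝ} (hq0 : 0 < q) (hq1 : q < 1) (N k : ℕ) (l a : ℕ → ℕ)
    (hN : ∀ i < k, l i < N) (hl : ∀ i, i + 1 < k → l (i + 1) < l i)
    (ha : ∀ i, i + 1 < k → a i ≤ a (i + 1)) :
    HasSum (fun t : Pattern k l a => q ^ patternSize k l t.1) (patternGF q k l a) := by
  induction N generalizing k l a with
  | zero =>
    obtain rfl : k = 0 := by
      by_contra h
      exact absurd (hN 0 (by omega)) (Nat.not_lt_zero _)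
    have hz : IsPattern 0 l a fun _ _ => 0 := ⟨by simp, by simp, by simp, by simp⟩
    have : Unique (Pattern 0 l a) :=
      ⟨⟨⟨_, hz⟩⟩, fun t => Subtype.ext (funext₂ fun i d => t.2.zero i d (by simp))⟩
    convert hasSum_unique (fun t : Pattern 0 l a => q ^ patternSize 0 l t.1)
    simp [patternGF, patternSize]
  | succ N ih =>
    -- `k'` is the number of rows with at least two cells; strictness of `l` gives `k - 1 ≤ k'`.
    obtain ⟨k', hk, hk', hiff⟩ : ∃ k' ≤ k, (k = k' ∨ k = k' + 1) ∧ ∀ i < k, 0 < l i ↔ i < k' := by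
      have hp : ∀ i, i + 1 < k → 0 < l i := fun i hi => (Nat.zero_le _).trans_lt (hl i hi)
      by_cases h : 0 < l (k - 1)
      · refine ⟨k, le_rfl, Or.inl rfl, fun i hi => ⟨fun _ => hi, fun _ => ?_⟩⟩
        rcases Nat.lt_or_ge (i + 1) k with h' | h'
        · exact hp i h'
        · rwa [show i = k - 1 by omega]
      · rcases Nat.eq_zero_or_pos k with rfl | hk0
        · exact ⟨0, le_rfl, Or.inl rfl, by simp⟩
        refine ⟨k - 1, by omega, by omega, fun i hi => ⟨fun hi' => ?_, fun _ => hp i (by omega)⟩⟩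
        by_contra hc
        exact h (by rwa [show k - 1 = i by omega])
    have hinner : ∀ b : (∀ j : Fin k', slot k a j), HasSum
        (fun t : Pattern k' (fun i => l i - 1) (extend fun j => b j) =>
          q ^ (∑ i ∈ range k, a i) * q ^ patternSize k' (fun i => l i - 1) t.1)
        (q ^ (∑ i ∈ range k, a i) *
          patternGF q k' (fun i => l i - 1) (extend fun j => b j)) := fun b => by
      refine (ih k' _ _ (fun i hi => ?_) (fun i hi => ?_) fun i hi => ?_).mul_left _
      · have := hN i (by omega)
        have := (hiff i (by omega)).2 hi
        omega
      · have := hl i (by omega)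
        have := (hiff (i + 1) (by omega)).2 hi
        omega
      · rw [extend_of_lt _ hi, extend_of_lt _ (Nat.lt_of_succ_lt hi)]
        exact ((b ⟨i, _⟩).2.2 (show i + 1 < k by omega)).trans (b ⟨i + 1, hi⟩).2.1
    have houter := hasSum_patternGF hq0 hq1 hk hiff ha hk'
    have hsig := houter.sigma_of_hasSum (f := fun p : Σ b : (∀ j : Fin k', slot k a j),
        Pattern k' (fun i => l i - 1) (extend fun j => b j) =>
          q ^ (∑ i ∈ range k, a i) * q ^ patternSize k' (fun i => l i - 1) p.2.1) hinner (by
      rw [summable_sigma_of_nonneg fun p => by positivity]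
      refine ⟨fun b => (hinner b).summable, ?_⟩
      simp only [(hinner _).tsum_eq]
      exact houter.summable)
    rw [← (peel (a := a) hk hiff).hasSum_iff] at hsig
    refine hsig.congr_fun fun t => ?_
    rw [patternSize_eq_add hk hiff t.2, pow_add]
    rfl

/-! ### Reverse plane partitions and Gelfand–Tsetlin patterns as diagonal patterns -/

theorem extend_add_delta_of_lt {n : ℕ} (lam : Fin n → ℕ) {i : ℕ} (h : i < n) :
    extend (lam + delta n) i = lam ⟨i, h⟩ + (n - 1 - i) := by
  simp [extend_of_lt _ h, delta]

theorem extend_add_delta_add_le {n : ℕ} {lam : Fin n → ℕ} (hlam : Antitone lam) {i m : ℕ}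
    (h : i + m < n) : extend (lam + delta n) (i + m) + m ≤ extend (lam + delta n) i := by
  rw [extend_add_delta_of_lt lam h, extend_add_delta_of_lt lam (by omega : i < n)]
  have := hlam (show (⟨i, by omega⟩ : Fin n) ≤ ⟨i + m, h⟩ from Nat.le_add_right i m)
  omega

theorem mem_shape {n : ℕ} (lam : Fin n → ℕ) (i c : ℕ) :
    (i, c) ∈ shape lam ↔ i < n ∧ i ≤ c ∧ c - i ≤ extend (lam + delta n) i := by
  simp only [shape, shiftedDiagram, mem_biUnion, mem_univ, true_and, mem_image, mem_Ico,
    Prod.mk.injEq]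
  constructor
  · rintro ⟨k, c', ⟨h1, h2⟩, rfl, rfl⟩
    refine ⟨k.2, h1, ?_⟩
    rw [extend_add_delta_of_lt lam k.2]
    simp only [deltaSucc, Pi.add_apply] at h2
    simp only [Fin.eta]
    omega
  · rintro ⟨h, h1, h2⟩
    refine ⟨⟨i, h⟩, c, ⟨h1, ?_⟩, rfl, rfl⟩
    rw [extend_add_delta_of_lt lam h] at h2
    simp [deltaSucc]
    omega

theorem mem_gtIndex {n : ℕ} (lam : Fin n → ℕ) (p : ℤ × ℤ) :
    p ∈ gtIndex lam ↔
      ∃ r d : ℕ, r < n ∧ d ≤ extend (lam + delta n) r ∧ p = ((n : ℤ) - r - d, (r : ℤ) + 1) := by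
  obtain ⟨x, y⟩ := p
  simp only [gtIndex, mem_biUnion, mem_univ, true_and, mem_image, mem_Icc, Prod.mk.injEq]
  constructor
  · rintro ⟨k, x', ⟨h1, h2⟩, rfl, rfl⟩
    refine ⟨k, ((n : ℤ) - k - x').toNat, k.2, ?_, by omega, rfl⟩
    rw [extend_add_delta_of_lt lam k.2]
    have := k.2
    simp only [Fin.eta]
    omega
  · rintro ⟨r, d, h, hd, rfl, rfl⟩
    rw [extend_add_delta_of_lt lam h] at hd
    exact ⟨⟨r, h⟩, _, ⟨by omega, by push_cast; omega⟩, rfl, rfl⟩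

theorem mk_mem_gtIndex {n : ℕ} (lam : Fin n → ℕ) (r d : ℕ) :
    ((n : ℤ) - r - d, (r : ℤ) + 1) ∈ gtIndex lam ↔ r < n ∧ d ≤ extend (lam + delta n) r := by
  rw [mem_gtIndex]
  constructor
  · rintro ⟨r', d', h, hd, he⟩
    rw [Prod.mk.injEq] at he
    obtain rfl : r = r' := by omega
    obtain rfl : d = d' := by omega
    exact ⟨h, hd⟩
  · rintro ⟨h, hd⟩
    exact ⟨r, d, h, hd, rfl⟩

theorem IsPattern.row_le {k : ℕ} {l a : ℕ → ℕ} {t : ℕ → ℕ → ℕ} (ht : IsPattern k l a t)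
    {i d d' : ℕ} (hi : i < k) (hd : d ≤ d') (hd' : d' ≤ l i) : t i d ≤ t i d' := by
  induction d', hd using Nat.le_induction with
  | base => exact le_rfl
  | succ m _ ih => exact (ih (by omega)).trans (ht.right i m hi hd')

/-- Going down `m` cells of a column stays inside of the shape, because the row lengths decrease
strictly. -/
theorem IsPattern.col_le {k : ℕ} {l a : ℕ → ℕ} {t : ℕ → ℕ → ℕ} (ht : IsPattern k l a t)
    (hl : ∀ i m, i + m < k → l (i + m) + m ≤ l i) {i m d : ℕ} (hi : i + m < k)
    (hd : d ≤ l (i + m)) : t i (d + m) ≤ t (i + m) d := by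
  induction m generalizing i with
  | zero => exact le_rfl
  | succ m ih =>
    have e : i + (m + 1) = i + 1 + m := by omega
    have h1 := hl (i + 1) m (by omega)
    have h2 := hl i (m + 1) hi
    rw [e] at hd h2 ⊢
    exact (ht.down i (d + m) (by omega) (by omega) (by omega)).trans (ih (by omega) hd)

/-- The diagonals of a reverse plane partition of shape `(δ_{n+1} + lam)^*`. -/
def rppEquiv {n : ℕ} {lam : Fin n → ℕ} (hlam : Antitone lam) (mu : Fin n → ℕ) :
    {T : RPP (shape lam) // T.rdiag n = mu} ≃
      Pattern n (extend (lam + delta n)) (extend fun i => mu i.rev) where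
  toFun T := ⟨fun i d => T.1.entry (i, i + d), by
    refine ⟨fun i d h => ?_, fun i h => ?_, fun i d h h' => ?_, fun i d h h' h'' => ?_⟩
    · refine T.1.zeros _ fun hm => h ?_
      rw [mem_shape] at hm
      exact ⟨hm.1, by omega⟩
    · have hT := congr_fun T.2 (Fin.rev ⟨i, h⟩)
      simp only [RPP.rdiag, Fin.rev_rev] at hT
      rw [extend_of_lt _ h, ← hT]
      rfl
    · refine T.1.row_weak _ _ _ (by omega) ?_ ?_ <;> rw [mem_shape]
      · exact ⟨h, by omega, by omega⟩
      · exact ⟨h, by omega, by omega⟩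
    · have e : i + 1 + d = i + (d + 1) := by omega
      rw [e]
      refine T.1.col_weak _ _ _ (by omega) ?_ ?_ <;> rw [mem_shape]
      · exact ⟨by omega, by omega, by omega⟩
      · exact ⟨h, by omega, by omega⟩⟩
  invFun t := ⟨
    { entry := fun c => if c.1 ≤ c.2 then t.1 c.1 (c.2 - c.1) else 0
      row_weak := fun i j j' hj h h' => by
        rw [mem_shape] at h h'
        simp only [h.2.1, h'.2.1, if_true]
        exact t.2.row_le h.1 (by omega) h'.2.2
      col_weak := fun i i' j hi h h' => by
        rw [mem_shape] at h h'
        simp only [h.2.1, h'.2.1, if_true]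
        obtain ⟨m, rfl⟩ := Nat.exists_eq_add_of_le hi
        have hc := t.2.col_le (fun i m h => extend_add_delta_add_le hlam h) h'.1 h'.2.2
        have e : j - (i + m) + m = j - i := by omega
        rwa [e] at hc
      zeros := fun c hc => by
        split_ifs with h
        · exact t.2.zero _ _ fun h' => hc ((mem_shape lam c.1 c.2).2 ⟨h'.1, h, h'.2⟩)
        · rfl }, by
    funext i
    simp only [RPP.rdiag, le_refl, if_true, Nat.sub_self]
    rw [t.2.start _ (Fin.rev i).2, extend_val, Fin.rev_rev]⟩
  left_inv T := by
    obtain ⟨⟨e, h1, h2, h3⟩, hT⟩ := T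
    simp only [Subtype.mk.injEq, RPP.mk.injEq]
    funext ⟨i, c⟩
    simp only
    split_ifs with h
    · rw [Nat.add_sub_cancel' h]
    · exact (h3 _ fun hm => h ((mem_shape lam i c).1 hm).2.1).symm
  right_inv t := by
    apply Subtype.ext
    funext i d
    simp

theorem patternSize_rppEquiv {n : ℕ} {lam mu : Fin n → ℕ} (hlam : Antitone lam)
    (T : {T : RPP (shape lam) // T.rdiag n = mu}) :
    patternSize n (extend (lam + delta n)) (rppEquiv hlam mu T).1 = T.1.size := by
  rw [patternSize, sum_sigma', RPP.size]
  refine sum_nbij' (fun p => (p.1, p.1 + p.2)) (fun c => ⟨c.1, c.2 - c.1⟩) ?_ ?_ ?_ ?_ ?_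
  · rintro ⟨i, d⟩ h
    simp only [mem_sigma, mem_range] at h
    exact (mem_shape _ _ _).2 ⟨h.1, Nat.le_add_right _ _, by simp only; omega⟩
  · rintro ⟨i, c⟩ h
    rw [mem_shape] at h
    simp only [mem_sigma, mem_range]
    exact ⟨h.1, by omega⟩
  · rintro ⟨i, d⟩ _
    simp
  · rintro ⟨i, c⟩ h
    rw [mem_shape] at h
    simp [Nat.add_sub_cancel' h.2.1]
  · rintro ⟨i, d⟩ _
    rfl

/-- The array of Gelfand–Tsetlin type with the same entries as a diagonal pattern: the `d`-th cell
of row `r` has the index `(n - r - d, r + 1)`. -/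
def gtEntry (n : ℕ) (t : ℕ → ℕ → ℕ) (p : ℤ × ℤ) : ℕ :=
  if 1 ≤ p.2 ∧ p.1 + p.2 ≤ n + 1 then t (p.2 - 1).toNat (n + 1 - p.2 - p.1).toNat else 0

theorem gtEntry_mk (n : ℕ) (t : ℕ → ℕ → ℕ) (r d : ℕ) :
    gtEntry n t ((n : ℤ) - r - d, (r : ℤ) + 1) = t r d := by
  rw [gtEntry, if_pos ⟨by simp, by simp; omega⟩]
  congr 1
  · simp
  · simp only; omega

/-- The rows of a shifted reverse plane partition are the columns of a Gelfand–Tsetlin pattern,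
read upside down. -/
def gtEquiv {n : ℕ} (lam mu : Fin n → ℕ) :
    GT lam mu ≃ Pattern n (extend (lam + delta n)) (extend fun i => mu i.rev) where
  toFun T := ⟨fun r d => T.entry ((n : ℤ) - r - d, (r : ℤ) + 1), by
    refine ⟨fun r d h => ?_, fun r h => ?_, fun r d h h' => ?_, fun r d h h' h'' => ?_⟩
    · exact T.zeros _ fun hm => h ((mk_mem_gtIndex lam r d).1 hm)
    · rw [extend_of_lt _ h, ← T.diag]
      congr 2 <;> simp [Fin.val_rev] <;> omega
    · have e : (n : ℤ) - r - d = (n : ℤ) - r - (d + 1 : ℕ) + 1 := by push_cast; ring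
      have h1 := (mk_mem_gtIndex lam r d).2 ⟨h, by omega⟩
      have h2 := (mk_mem_gtIndex lam r (d + 1)).2 ⟨h, h'⟩
      rw [e] at h1 ⊢
      exact T.le_left _ _ h2 h1
    · have h1 := (mk_mem_gtIndex lam r (d + 1)).2 ⟨by omega, h'⟩
      have h2 := (mk_mem_gtIndex lam (r + 1) d).2 ⟨h, h''⟩
      have e : (n : ℤ) - (r + 1 : ℕ) - d = (n : ℤ) - r - (d + 1 : ℕ) := by push_cast; ring
      have e' : ((r + 1 : ℕ) : ℤ) + 1 = (r : ℤ) + 1 + 1 := by push_cast; ring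
      rw [e, e'] at h2 ⊢
      exact T.le_up _ _ h1 h2⟩
  invFun t :=
    { entry := gtEntry n t.1
      le_up := fun i j h h' => by
        obtain ⟨r, d, hr, hd, he⟩ := (mem_gtIndex _ _).1 h
        obtain ⟨r', d', hr', hd', he'⟩ := (mem_gtIndex _ _).1 h'
        rw [he, he', gtEntry_mk, gtEntry_mk]
        rw [Prod.mk.injEq] at he he'
        obtain rfl : r' = r + 1 := by omega
        obtain rfl : d = d' + 1 := by omega
        exact t.2.down _ _ hr' hd hd'
      le_left := fun i j h h' => by
        obtain ⟨r, d, hr, hd, he⟩ := (mem_gtIndex _ _).1 h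
        obtain ⟨r', d', hr', hd', he'⟩ := (mem_gtIndex _ _).1 h'
        rw [he, he', gtEntry_mk, gtEntry_mk]
        rw [Prod.mk.injEq] at he he'
        obtain rfl : r' = r := by omega
        obtain rfl : d = d' + 1 := by omega
        exact t.2.right _ _ hr hd
      diag := fun k => by
        have e : ((k : ℤ) + 1, (n : ℤ) + 1 - ((k : ℤ) + 1))
            = ((n : ℤ) - (k.rev : ℕ) - (0 : ℕ), ((k.rev : ℕ) : ℤ) + 1) := by
          rw [Prod.mk.injEq, Fin.val_rev]
          omega
        rw [e, gtEntry_mk, t.2.start _ k.rev.2, extend_val, Fin.rev_rev]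
      zeros := fun p hp => by
        rw [gtEntry]
        split_ifs with h
        · refine t.2.zero _ _ fun h' => hp ((mem_gtIndex _ _).2 ⟨_, _, h'.1, h'.2, ?_⟩)
          refine Prod.ext ?_ ?_ <;> simp only <;> omega
        · rfl }
  left_inv T := by
    obtain ⟨e, h1, h2, h3, h4⟩ := T
    simp only [GT.mk.injEq]
    funext p
    by_cases hp : p ∈ gtIndex lam
    · obtain ⟨r, d, -, -, rfl⟩ := (mem_gtIndex _ _).1 hp
      rw [gtEntry_mk]
    · rw [h4 p hp, gtEntry]
      split_ifs with h
      · refine h4 _ fun hm => hp ?_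
        convert hm using 1
        refine Prod.ext ?_ ?_ <;> simp only <;> omega
      · rfl
  right_inv t := by
    apply Subtype.ext
    funext r d
    exact gtEntry_mk n t.1 r d

theorem patternSize_gtEquiv {n : ℕ} {lam mu : Fin n → ℕ} (T : GT lam mu) :
    patternSize n (extend (lam + delta n)) (gtEquiv lam mu T).1 = T.size := by
  rw [patternSize, sum_sigma', GT.size]
  refine sum_bij (fun p _ => ((n : ℤ) - p.1 - p.2, (p.1 : ℤ) + 1)) ?_ ?_ ?_ ?_
  · rintro ⟨r, d⟩ h
    simp only [mem_sigma, mem_range, Nat.lt_succ_iff] at h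
    exact (mk_mem_gtIndex _ _ _).2 h
  · rintro ⟨r, d⟩ _ ⟨r', d'⟩ _ he
    simp only [Prod.mk.injEq] at he
    obtain rfl : r = r' := by omega
    obtain rfl : d = d' := by omega
    rfl
  · intro p hp
    obtain ⟨r, d, hr, hd, rfl⟩ := (mem_gtIndex _ _).1 hp
    exact ⟨⟨r, d⟩, by simpa [Nat.lt_succ_iff] using ⟨hr, hd⟩, rfl⟩
  · rintro ⟨r, d⟩ _
    rfl

/-! ### Vandermonde determinants and Schur functions -/

theorem vdmBar_eq_det {n : ℕ} (x : Fin n → ℝ) : vdmBar x = (Matrix.vandermonde x).det :=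
  (Matrix.det_vandermonde x).symm

theorem alternant_delta {n : ℕ} (x : Fin n → ℝ) :
    alternant (delta n) x = Equiv.Perm.sign (Fin.revPerm : Equiv.Perm (Fin n)) * vdmBar x := by
  rw [vdmBar_eq_det, ← Matrix.det_transpose (Matrix.vandermonde x), ← Matrix.det_permute, alternant]
  congr 1
  ext i j
  simp [delta, Matrix.vandermonde, Fin.val_rev, Nat.sub_sub, add_comm]

theorem vdmBar_ne_zero {n : ℕ} {x : Fin n → ℝ} (hx : Function.Injective x) : vdmBar x ≠ 0 := by
  rw [vdmBar_eq_det]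
  exact Matrix.det_vandermonde_ne_zero_iff.2 hx

theorem strictAnti_add_delta {n : ℕ} {mu : Fin n → ℕ} (hmu : Antitone mu) :
    StrictAnti (mu + delta n) := fun i j h => by
  have := hmu h.le
  have h' : (i : ℕ) < j := h
  simp only [Pi.add_apply, delta]
  omega

theorem qpow_injective {q : ℝ} (hq0 : 0 < q) (hq1 : q < 1) {n : ℕ} {a : Fin n → ℕ}
    (ha : StrictAnti a) : Function.Injective (qpow q a) := fun _ _ h =>
  ha.injective (pow_right_injective₀ hq0 hq1.ne h)

theorem sign_mul_self (n : ℕ) (σ : Equiv.Perm (Fin n)) :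
    ((Equiv.Perm.sign σ : ℤ) : ℝ) * (Equiv.Perm.sign σ : ℤ) = 1 := by
  rw [← Int.cast_mul, ← Units.val_mul, Int.units_mul_self]
  simp

/-- Both `alternant (delta n)` and the matrix with reversed columns cost the sign of the reversal, so
the signs cancel. -/
theorem schur_mul_vdmBar {n : ℕ} (lam : Fin n → ℕ) {x : Fin n → ℝ} (hx : Function.Injective x) :
    schur lam x * vdmBar x = (Matrix.of fun i j => x (Fin.rev j) ^ (lam + delta n) i).det := by
  have h : (Matrix.of fun i j => x (Fin.rev j) ^ (lam + delta n) i).det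
      = Equiv.Perm.sign (Fin.revPerm : Equiv.Perm (Fin n)) * alternant (lam + delta n) x := by
    rw [alternant, ← Matrix.det_permute']
    rfl
  rw [h, schur, alternant_delta]
  have hs := sign_mul_self n Fin.revPerm
  have hs0 := left_ne_zero_of_mul_eq_one hs
  have hv := vdmBar_ne_zero hx
  field_simp
  rw [pow_two, hs, mul_one]

/-- Exchanging the exponents with the points transposes the alternant in the numerator. -/
theorem schur_qpow_delta (q : ℝ) {n : ℕ} (mu : Fin n → ℕ) :
    schur mu (qpow q (delta n)) = vdmBar (qpow q (mu + delta n)) / vdmBar (qpow q (delta n)) := by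
  have h : alternant (mu + delta n) (qpow q (delta n))
      = alternant (delta n) (qpow q (mu + delta n)) := by
    rw [alternant, alternant, ← Matrix.det_transpose]
    congr 1
    ext i j
    simp [qpow, ← pow_mul, mul_comm]
  have hs0 := left_ne_zero_of_mul_eq_one (sign_mul_self n Fin.revPerm)
  rw [schur, h, alternant_delta, alternant_delta, mul_div_mul_left _ _ hs0]

/-- The Vandermonde product at the principal specialization. -/
theorem vdmBar_qpow_delta (q : ℝ) (n : ℕ) :
    vdmBar (qpow q (delta n)) = q ^ b (delta n) * ∏ j : Fin n, qPoch q q (delta n j) := by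
  induction n with
  | zero => simp [vdmBar, b]
  | succ n ih =>
    have h0 : delta (n + 1) 0 = n := rfl
    have hs : ∀ j : Fin n, delta (n + 1) j.succ = delta n j := fun j => by
      simp only [delta, Fin.val_succ]
      omega
    have hb : b (delta (n + 1)) = ∑ j : Fin n, delta n j + b (delta n) := by
      rw [b, Fin.sum_univ_succ, b, ← sum_add_distrib]
      simp only [Fin.val_zero, zero_mul, zero_add, hs, Fin.val_succ]
      exact sum_congr rfl fun j _ => by ring
    have hv : vdmBar (qpow q (delta (n + 1)))
        = (∏ j : Fin n, (q ^ delta n j - q ^ n)) * vdmBar (qpow q (delta n)) := by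
      simp only [vdmBar, Fin.prod_univ_succ, Fin.prod_Ioi_zero, Fin.prod_Ioi_succ, qpow, hs, h0]
    have hp : ∏ j : Fin n, (q ^ delta n j - q ^ n) = q ^ (∑ j : Fin n, delta n j) * qPoch q q n := by
      rw [← prod_pow_eq_pow_sum, qPoch, ← Fin.prod_univ_eq_prod_range (fun k => 1 - q * q ^ k),
        ← prod_mul_distrib]
      refine prod_congr rfl fun j _ => ?_
      have e : n = delta n j + (j + 1) := by
        have := j.2
        simp only [delta]
        omega
      have hq : q ^ n = q ^ delta n j * q ^ ((j : ℕ) + 1) := by rw [← pow_add, ← e]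
      rw [hq]
      ring
    rw [hv, hp, ih, Fin.prod_univ_succ, hb, h0, pow_add]
    simp only [hs]
    ring

theorem patternGF_eq {q : ℝ} (hq0 : 0 < q) (hq1 : q < 1) {n : ℕ} (lam : Fin n → ℕ)
    {mu : Fin n → ℕ} (hmu : Antitone mu) :
    patternGF q n (extend (lam + delta n)) (extend fun i => mu i.rev)
      = q ^ (-(b (deltaSucc n + lam) : ℤ)) / (∏ j : Fin n, qPoch q q (lam j + delta n j)) *
        q ^ wt (mu + delta n) * schur lam (qpow q (mu + delta n)) *
        vdmBar (qpow q (mu + delta n)) := by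
  have hrev : ∀ j : Fin n, delta n j.rev = j := fun j => by
    have := j.2
    simp only [delta, Fin.val_rev]
    omega
  have hw : ∑ j ∈ range n, (extend (fun i => mu i.rev) j + j) = wt (mu + delta n) := by
    rw [← Fin.sum_univ_eq_sum_range (fun j => extend (fun i : Fin n => mu i.rev) j + j), wt,
      ← Equiv.sum_comp Fin.revPerm (mu + delta n)]
    simp only [extend_val, Fin.revPerm_apply, Pi.add_apply, hrev]
  have hE : ∑ i ∈ range n, i * (extend (lam + delta n) i + 1) = b (deltaSucc n + lam) := by
    rw [← Fin.sum_univ_eq_sum_range (fun i => i * (extend (lam + delta n) i + 1)), b]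
    refine sum_congr rfl fun i _ => ?_
    have := i.2
    simp only [extend_val, Pi.add_apply, delta, deltaSucc]
    congr 1
    omega
  have hP : ∏ i ∈ range n, qPoch q q (extend (lam + delta n) i)
      = ∏ j : Fin n, qPoch q q (lam j + delta n j) := by
    rw [← Fin.prod_univ_eq_prod_range (fun i => qPoch q q (extend (lam + delta n) i))]
    simp
  have hD : (Matrix.of fun i j : Fin n =>
      (q ^ extend (lam + delta n) i) ^ (extend (fun i => mu i.rev) j + j)).det
      = schur lam (qpow q (mu + delta n)) * vdmBar (qpow q (mu + delta n)) := by
    rw [schur_mul_vdmBar lam (qpow_injective hq0 hq1 (strictAnti_add_delta hmu))]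
    congr 1
    ext i j
    simp only [Matrix.of_apply, extend_val, qpow, Pi.add_apply, hrev]
    rw [← pow_mul, ← pow_mul, mul_comm]
  rw [patternGF, hw, hE, hP, hD, zpow_neg, zpow_natCast]
  ring

theorem b_add {n : ℕ} (x y : Fin n → ℕ) : b (x + y) = b x + b y := by
  simp [b, mul_add, sum_add_distrib]

theorem b_deltaSucc (n : ℕ) : b (deltaSucc n) = b (delta n) + wt (delta n) := by
  have h : wt (delta n) = ∑ i : Fin n, (i : ℕ) := by
    rw [wt, ← Equiv.sum_comp Fin.revPerm]
    refine sum_congr rfl fun i _ => ?_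
    have := i.2
    simp only [delta, Fin.revPerm_apply, Fin.val_rev]
    omega
  rw [h, b, b, ← sum_add_distrib]
  refine sum_congr rfl fun i _ => ?_
  have : deltaSucc n i = delta n i + 1 := by
    have := i.2
    simp only [delta, deltaSucc]
    omega
  rw [this]
  ring

theorem zpow_wt_sub_b {q : ℝ} (hq0 : 0 < q) {n : ℕ} (lam mu : Fin n → ℕ) :
    q ^ ((wt mu : ℤ) - (b (delta n + lam) : ℤ))
      = q ^ (-(b (deltaSucc n + lam) : ℤ)) * q ^ wt (mu + delta n) := by
  rw [← zpow_natCast, ← zpow_add₀ hq0.ne', b_add, b_add, b_deltaSucc]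
  congr 1
  have : wt (mu + delta n) = wt mu + wt (delta n) := by simp [wt, sum_add_distrib]
  rw [this]
  push_cast
  ring

theorem qPoch_pos {q : ℝ} (hq0 : 0 < q) (hq1 : q < 1) (m : ℕ) : 0 < qPoch q q m :=
  prod_pos fun k _ => by
    rw [← pow_succ', sub_pos]
    exact pow_lt_one₀ hq0.le hq1 k.succ_ne_zero

theorem productForm_eq {q : ℝ} (hq0 : 0 < q) (hq1 : q < 1) {n : ℕ} (lam mu : Fin n → ℕ) :
    productForm q lam mu
      = q ^ ((wt mu : ℤ) - (b (delta n + lam) : ℤ)) /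
        (∏ j : Fin n, qPoch q q (lam j + delta n j)) * schur lam (qpow q (mu + delta n)) *
        vdmBar (qpow q (mu + delta n)) := by
  have hd : ∏ j : Fin n, qPoch q q (delta n j) ≠ 0 :=
    prod_ne_zero_iff.2 fun j _ => (qPoch_pos hq0 hq1 _).ne'
  have he : (wt mu : ℤ) - (b lam : ℤ)
      = ((wt mu : ℤ) - (b (delta n + lam) : ℤ)) + (b (delta n) : ℕ) := by
    rw [b_add]
    push_cast
    ring
  rw [productForm, schur_qpow_delta, vdmBar_qpow_delta, prod_div_distrib, he, zpow_add₀ hq0.ne',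
    zpow_natCast]
  have hb : q ^ b (delta n) ≠ 0 := by positivity
  field_simp

end QRPP

/-- Both generating functions, each in its product form and in its Vandermonde form. -/
theorem theorem7p4 (q : ℝ) (hq0 : 0 < q) (hq1 : q < 1) (n : ℕ) (lam mu : Fin n → ℕ)
    (hlam : Antitone lam) (hmu : Antitone mu) :
    HasSum (fun T : QRPP.GT lam mu => q ^ T.size) (QRPP.productForm q lam mu) ∧
    HasSum (fun T : QRPP.GT lam mu => q ^ T.size)
      (q ^ ((QRPP.wt mu : ℤ) - (QRPP.b (QRPP.delta n + lam) : ℤ)) /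
        (∏ j : Fin n, QRPP.qPoch q q (lam j + QRPP.delta n j)) *
        QRPP.schur lam (QRPP.qpow q (mu + QRPP.delta n)) *
        QRPP.vdmBar (QRPP.qpow q (mu + QRPP.delta n))) ∧
    HasSum (fun T : {T : QRPP.RPP (QRPP.shape lam) // T.rdiag n = mu} => q ^ T.1.size)
      (QRPP.productForm q lam mu) ∧
    HasSum (fun T : {T : QRPP.RPP (QRPP.shape lam) // T.rdiag n = mu} => q ^ T.1.size)
      (q ^ (-(QRPP.b (QRPP.deltaSucc n + lam) : ℤ)) /
        (∏ j : Fin n, QRPP.qPoch q q (lam j + QRPP.delta n j)) *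
        q ^ QRPP.wt (mu + QRPP.delta n) *
        QRPP.schur lam (QRPP.qpow q (mu + QRPP.delta n)) *
        QRPP.vdmBar (QRPP.qpow q (mu + QRPP.delta n))) := by
  -- The bound on the row lengths, which only has to exist, is `sup + 1`.
  have hmain := QRPP.hasSum_pattern hq0 hq1 _ n (QRPP.extend (lam + QRPP.delta n))
    (QRPP.extend fun i => mu i.rev)
    (fun i hi => Nat.lt_succ_of_le (Finset.le_sup (Finset.mem_range.2 hi)))
    (fun i hi => QRPP.extend_add_delta_add_le hlam hi)
    fun i hi => by
      rw [QRPP.extend_of_lt _ hi, QRPP.extend_of_lt _ (Nat.lt_of_succ_lt hi)]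
      exact hmu (Fin.rev_le_rev.2 (Nat.le_succ i))
  rw [QRPP.patternGF_eq hq0 hq1 lam hmu] at hmain
  have hGT := (QRPP.gtEquiv lam mu).hasSum_iff.2 hmain
  have hRPP := (QRPP.rppEquiv hlam mu).hasSum_iff.2 hmain
  simp only [Function.comp_def, QRPP.patternSize_gtEquiv] at hGT
  simp only [Function.comp_def, QRPP.patternSize_rppEquiv] at hRPP
  rw [QRPP.productForm_eq hq0 hq1, QRPP.zpow_wt_sub_b hq0, mul_div_right_comm]
  exact ⟨hGT, hGT, hRPP, hRPP⟩
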